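/- **Language of QHC.** The terms are the individual variables $x_0,x_1,\dots$. Every formula has exactly one of two types, *proposition* or *problem*. For each arity $n\ge 0$ there are countably many $n$-ary proposition variables and countably many $n$-ary problem variables; applied to terms they give the atomic propositions and the atomic problems. There are the constants $0$ (a proposition) and $\bot$ (a problem). Propositions are closed under the classical $\land,\lor,\to,\forall,\exists$, and problems under the intuitionistic $\land,\lor,\to,\forall,\exists$. If $p$ is a proposition, then $!p$ is a problem; if $\alpha$ is a problem, then $?\alpha$ is a proposition. As usual $\neg p:=(p\to 0)$, $\neg\alpha:=(\alpha\to\bot)$, and $\leftrightarrow$ is the conjunction of the two implications. **The calculus QHC** has all axiom schemes and inference rules of classical predicate logic for all propositions, all those of intuitionistic predicate logic for all problems, the axiom schemes $$?(\alpha\land\beta)\leftrightarrow(?\alpha\land{?\beta}),\quad ?(\alpha\lor\beta)\leftrightarrow(?\alpha\lor{?\beta}),\quad ?(\alpha\to\beta)\to(?\alpha\to{?\beta}),\quad \neg{?\bot},$$ $$?\exists x\,\alpha\leftrightarrow\exists x\,?\alpha,\quad ?\forall x\,\alpha\to\forall x\,?\alpha,\quad \neg{!0},\quad ?!p\to p,\quad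 !(p\to q)\to(!p\to{!q}),\quad \alpha\to{!?\alpha},$$ and the inference rules $\alpha\,/\,?\alpha$ and $p\,/\,!p$. **The calculus QS4** (quantified modal logic S4) is classical predicate logic with a unary operator $\Box$, the axiom schemes $\Box p\to p$, $\Box p\to\Box\Box p$, $\Box(p\to q)\to(\Box p\to\Box q)$, and the rule $p\,/\,\Box p$. Its predicate variables are the proposition variables of QHC and, possibly, further ones. In both calculi $A_1,\dots,A_n\vdash A$ means that $A$ can be obtained from $A_1,\dots,A_n$ and instances of the axiom schemes by the inference rules, all of which (including generalization $A\,/\,\forall x\,A$ and the rules $\alpha\,/\,?\alpha$, $p\,/\,!p$, $p\,/\,\Box p$) may be applied to any formulas derived so far. **The $\Box$-interpretation.** Fix any assignment $\pi\mapsto\hat\pi$ that retypes each problem variable as a predicate variable of QS4 of the same arity. For a formula $A$ of QHC define the formula $A_\Box$ of QS4 recursively: - an atomic proposition is unchanged, and $0_\Box=\bot_\Box=0$; - $\pi(t_1,\dots,t_n)_\Box=\Box\,\hat\pi(t_1,\dots,t_n)$ for an atomic problem; - $(A\land B)_\Box=A_\Box\land B_\Box$, $(A\lor B)_\Box=A_\Box\lor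 B_\Box$ and $(\exists x\,A)_\Box=\exists x\,A_\Box$ for formulas of either type; - $(p\to q)_\Box=p_\Box\to q_\Box$ and $(\forall x\,p)_\Box=\forall x\,p_\Box$ for propositions $p,q$; - $(\alpha\to\beta)_\Box=\Box(\alpha_\Box\to\beta_\Box)$ and $(\forall x\,\alpha)_\Box=\Box\forall x\,\alpha_\Box$ for problems $\alpha,\beta$; - $(?\alpha)_\Box=\alpha_\Box$ and $(!p)_\Box=\Box p_\Box$. **Theorem.** Let $A_1,\dots,A_n,A$ be formulas of QHC, each of either type. If $A_1,\dots,A_n\vdash_{QHC}A$, then $(A_1)_\Box,\dots,(A_n)_\Box\vdash_{QS4}A_\Box$. -/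

import Mathlib

/-! ## The language and the calculus QHC -/

/-- The two types of formulas of QHC. -/
inductive Kind : Type
  | proposition
  | problem

/-- Formulas of QHC of each of the two types. The terms are the individual variables `x₀, x₁, …`,
represented by natural numbers.

`atom s n k t` is the `k`-th `n`-ary logical variable of type `s` applied to the terms
`t 0, …, t (n - 1)`. `falsum` is the classical constant `0` for propositions and the intuitionistic
constant `⊥` for problems. The connectives `and`, `or`, `imp` and the quantifiers `all`, `ex` are
the classical ones on propositions and the intuitionistic ones on problems. `bang` is `!`, and
`quest` is `?`. -/
inductive QHCFormula : Kind → Type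
  | atom (s : Kind) (n k : ℕ) (t : Fin n → ℕ) : QHCFormula s
  | falsum (s : Kind) : QHCFormula s
  | and {s : Kind} (A B : QHCFormula s) : QHCFormula s
  | or {s : Kind} (A B : QHCFormula s) : QHCFormula s
  | imp {s : Kind} (A B : QHCFormula s) : QHCFormula s
  | all {s : Kind} (x : ℕ) (A : QHCFormula s) : QHCFormula s
  | ex {s : Kind} (x : ℕ) (A : QHCFormula s) : QHCFormula s
  | bang (p : QHCFormula .proposition) : QHCFormula .problem
  | quest (a : QHCFormula .problem) : QHCFormula .proposition

namespace QHCFormula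

/-- Negation `A → 0`, respectively `A → ⊥`. -/
def neg {s : Kind} (A : QHCFormula s) : QHCFormula s := imp A (falsum s)

/-- The biconditional. -/
def iff {s : Kind} (A B : QHCFormula s) : QHCFormula s := and (imp A B) (imp B A)

/-- The variable `x` occurs free in a formula. -/
def IsFree (x : ℕ) : {s : Kind} → QHCFormula s → Prop
  | _, atom _ _ _ t => ∃ i, t i = x
  | _, falsum _ => False
  | _, and A B => IsFree x A ∨ IsFree x B
  | _, or A B => IsFree x A ∨ IsFree x B
  | _, imp A B => IsFree x A ∨ IsFree x B
  | _, all z A => x ≠ z ∧ IsFree x A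
  | _, ex z A => x ≠ z ∧ IsFree x A
  | _, bang p => IsFree x p
  | _, quest a => IsFree x a

/-- The result of replacing all free occurrences of `x` by `y`. -/
def subst (x y : ℕ) : {s : Kind} → QHCFormula s → QHCFormula s
  | _, atom s n k t => atom s n k (fun i => if t i = x then y else t i)
  | _, falsum s => falsum s
  | _, and A B => and (subst x y A) (subst x y B)
  | _, or A B => or (subst x y A) (subst x y B)
  | _, imp A B => imp (subst x y A) (subst x y B)
  | _, all z A => if z = x then all z A else all z (subst x y A)
  | _, ex z A => if z = x then ex z A else ex z (subst x y A)
  | _, bang p => bang (subst x y p)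
  | _, quest a => quest (subst x y a)

/-- The variable `y` is free for `x` in a formula: no free occurrence of `x` is within the scope of
a quantifier that binds `y`. -/
def FreeFor (x y : ℕ) : {s : Kind} → QHCFormula s → Prop
  | _, atom _ _ _ _ => True
  | _, falsum _ => True
  | _, and A B => FreeFor x y A ∧ FreeFor x y B
  | _, or A B => FreeFor x y A ∧ FreeFor x y B
  | _, imp A B => FreeFor x y A ∧ FreeFor x y B
  | _, all z A => IsFree x (all z A) → z ≠ y ∧ FreeFor x y A
  | _, ex z A => IsFree x (ex z A) → z ≠ y ∧ FreeFor x y A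
  | _, bang p => FreeFor x y p
  | _, quest a => FreeFor x y a

end QHCFormula

/-- A formula of QHC of unspecified type. -/
abbrev QHCAnyFormula : Type := (s : Kind) × QHCFormula s

open QHCFormula in
/-- `QHCDerivable Γ A`: the formula `A` is derivable in QHC from the premises `Γ`, that is, obtained
from premises and primary laws by the inference rules, each of which (generalization and
the rules `p / !p` and `α / ?α` included) may be applied to everything derived so far. -/
inductive QHCDerivable (Γ : Set QHCAnyFormula) : {s : Kind} → QHCFormula s → Prop
  | premise {s : Kind} {A : QHCFormula s} (h : (⟨s, A⟩ : QHCAnyFormula) ∈ Γ) : QHCDerivable Γ A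
  -- Intuitionistic predicate logic for problems; the same schemes and rules for propositions.
  | mp {s : Kind} {A B : QHCFormula s} :
      QHCDerivable Γ A → QHCDerivable Γ (imp A B) → QHCDerivable Γ B
  | gen {s : Kind} {A : QHCFormula s} (x : ℕ) : QHCDerivable Γ A → QHCDerivable Γ (all x A)
  | impK {s : Kind} (A B : QHCFormula s) : QHCDerivable Γ (imp A (imp B A))
  | impS {s : Kind} (A B C : QHCFormula s) :
      QHCDerivable Γ (imp (imp A (imp B C)) (imp (imp A B) (imp A C)))
  | andLeft {s : Kind} (A B : QHCFormula s) : QHCDerivable Γ (imp (and A B) A)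
  | andRight {s : Kind} (A B : QHCFormula s) : QHCDerivable Γ (imp (and A B) B)
  | andIntro {s : Kind} (A B : QHCFormula s) : QHCDerivable Γ (imp A (imp B (and A B)))
  | orLeft {s : Kind} (A B : QHCFormula s) : QHCDerivable Γ (imp A (or A B))
  | orRight {s : Kind} (A B : QHCFormula s) : QHCDerivable Γ (imp B (or A B))
  | orElim {s : Kind} (A B C : QHCFormula s) :
      QHCDerivable Γ (imp (imp A C) (imp (imp B C) (imp (or A B) C)))
  | explosion {s : Kind} (A : QHCFormula s) : QHCDerivable Γ (imp (falsum s) A)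
  | allElim {s : Kind} (x y : ℕ) (A : QHCFormula s) (h : FreeFor x y A) :
      QHCDerivable Γ (imp (all x A) (subst x y A))
  | exIntro {s : Kind} (x y : ℕ) (A : QHCFormula s) (h : FreeFor x y A) :
      QHCDerivable Γ (imp (subst x y A) (ex x A))
  | allImp {s : Kind} (x : ℕ) (A B : QHCFormula s) (h : ¬ IsFree x A) :
      QHCDerivable Γ (imp (all x (imp A B)) (imp A (all x B)))
  | exImp {s : Kind} (x : ℕ) (A B : QHCFormula s) (h : ¬ IsFree x B) :
      QHCDerivable Γ (imp (all x (imp A B)) (imp (ex x A) B))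
  -- Classical logic for propositions: the law of excluded middle in addition.
  | excludedMiddle (p : QHCFormula .proposition) : QHCDerivable Γ (or p (neg p))
  -- First group.
  | questAnd (a b : QHCFormula .problem) :
      QHCDerivable Γ (iff (quest (and a b)) (and (quest a) (quest b)))
  | questOr (a b : QHCFormula .problem) :
      QHCDerivable Γ (iff (quest (or a b)) (or (quest a) (quest b)))
  | questImp (a b : QHCFormula .problem) :
      QHCDerivable Γ (imp (quest (imp a b)) (imp (quest a) (quest b)))
  | questFalsum : QHCDerivable Γ (neg (quest (falsum .problem)))
  | questEx (x : ℕ) (a : QHCFormula .problem) :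
      QHCDerivable Γ (iff (quest (ex x a)) (ex x (quest a)))
  | questAll (x : ℕ) (a : QHCFormula .problem) :
      QHCDerivable Γ (imp (quest (all x a)) (all x (quest a)))
  | questTop {a : QHCFormula .problem} : QHCDerivable Γ a → QHCDerivable Γ (quest a)
  -- Second group.
  | bangFalsum : QHCDerivable Γ (neg (bang (falsum .proposition)))
  | questBang (p : QHCFormula .proposition) : QHCDerivable Γ (imp (quest (bang p)) p)
  | bangImp (p q : QHCFormula .proposition) :
      QHCDerivable Γ (imp (bang (imp p q)) (imp (bang p) (bang q)))
  | bangTop {p : QHCFormula .proposition} : QHCDerivable Γ p → QHCDerivable Γ (bang p)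
  -- Third group.
  | bangQuest (a : QHCFormula .problem) : QHCDerivable Γ (imp a (bang (quest a)))

/-! ## The language and the calculus QS4 -/

/-- Formulas of QS4 whose `n`-ary predicate variables (propositional variables if `n = 0`) are the
elements of `V n`; the terms are again the individual variables. -/
inductive QS4Formula (V : ℕ → Type) : Type
  | atom (n : ℕ) (P : V n) (t : Fin n → ℕ) : QS4Formula V
  | falsum : QS4Formula V
  | and (A B : QS4Formula V) : QS4Formula V
  | or (A B : QS4Formula V) : QS4Formula V
  | imp (A B : QS4Formula V) : QS4Formula V
  | all (x : ℕ) (A : QS4Formula V) : QS4Formula V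
  | ex (x : ℕ) (A : QS4Formula V) : QS4Formula V
  | box (A : QS4Formula V) : QS4Formula V

namespace QS4Formula

variable {V : ℕ → Type}

/-- Negation `A → 0`. -/
def neg (A : QS4Formula V) : QS4Formula V := imp A falsum

/-- The variable `x` occurs free in a formula. -/
def IsFree (x : ℕ) : QS4Formula V → Prop
  | atom _ _ t => ∃ i, t i = x
  | falsum => False
  | and A B => IsFree x A ∨ IsFree x B
  | or A B => IsFree x A ∨ IsFree x B
  | imp A B => IsFree x A ∨ IsFree x B
  | all z A => x ≠ z ∧ IsFree x A
  | ex z A => x ≠ z ∧ IsFree x A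
  | box A => IsFree x A

/-- The result of replacing all free occurrences of `x` by `y`. -/
def subst (x y : ℕ) : QS4Formula V → QS4Formula V
  | atom n P t => atom n P (fun i => if t i = x then y else t i)
  | falsum => falsum
  | and A B => and (subst x y A) (subst x y B)
  | or A B => or (subst x y A) (subst x y B)
  | imp A B => imp (subst x y A) (subst x y B)
  | all z A => if z = x then all z A else all z (subst x y A)
  | ex z A => if z = x then ex z A else ex z (subst x y A)
  | box A => box (subst x y A)

/-- The variable `y` is free for `x` in a formula: no free occurrence of `x` is within the scope of
a quantifier that binds `y`. -/
def FreeFor (x y : ℕ) : QS4Formula V → Prop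
  | atom _ _ _ => True
  | falsum => True
  | and A B => FreeFor x y A ∧ FreeFor x y B
  | or A B => FreeFor x y A ∧ FreeFor x y B
  | imp A B => FreeFor x y A ∧ FreeFor x y B
  | all z A => IsFree x (all z A) → z ≠ y ∧ FreeFor x y A
  | ex z A => IsFree x (ex z A) → z ≠ y ∧ FreeFor x y A
  | box A => FreeFor x y A

end QS4Formula

open QS4Formula in
/-- `QS4Derivable Γ A`: the formula `A` is derivable in QS4 from the premises `Γ`; as in QHC, all
inference rules (generalization and necessitation included) may be applied to everything
derived so far. -/
inductive QS4Derivable {V : ℕ → Type} (Γ : Set (QS4Formula V)) : QS4Formula V → Prop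
  | premise {A : QS4Formula V} (h : A ∈ Γ) : QS4Derivable Γ A
  -- Classical predicate logic.
  | mp {A B : QS4Formula V} : QS4Derivable Γ A → QS4Derivable Γ (imp A B) → QS4Derivable Γ B
  | gen {A : QS4Formula V} (x : ℕ) : QS4Derivable Γ A → QS4Derivable Γ (all x A)
  | impK (A B : QS4Formula V) : QS4Derivable Γ (imp A (imp B A))
  | impS (A B C : QS4Formula V) :
      QS4Derivable Γ (imp (imp A (imp B C)) (imp (imp A B) (imp A C)))
  | andLeft (A B : QS4Formula V) : QS4Derivable Γ (imp (and A B) A)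
  | andRight (A B : QS4Formula V) : QS4Derivable Γ (imp (and A B) B)
  | andIntro (A B : QS4Formula V) : QS4Derivable Γ (imp A (imp B (and A B)))
  | orLeft (A B : QS4Formula V) : QS4Derivable Γ (imp A (or A B))
  | orRight (A B : QS4Formula V) : QS4Derivable Γ (imp B (or A B))
  | orElim (A B C : QS4Formula V) :
      QS4Derivable Γ (imp (imp A C) (imp (imp B C) (imp (or A B) C)))
  | explosion (A : QS4Formula V) : QS4Derivable Γ (imp falsum A)
  | allElim (x y : ℕ) (A : QS4Formula V) (h : FreeFor x y A) :
      QS4Derivable Γ (imp (all x A) (subst x y A))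
  | exIntro (x y : ℕ) (A : QS4Formula V) (h : FreeFor x y A) :
      QS4Derivable Γ (imp (subst x y A) (ex x A))
  | allImp (x : ℕ) (A B : QS4Formula V) (h : ¬ IsFree x A) :
      QS4Derivable Γ (imp (all x (imp A B)) (imp A (all x B)))
  | exImp (x : ℕ) (A B : QS4Formula V) (h : ¬ IsFree x B) :
      QS4Derivable Γ (imp (all x (imp A B)) (imp (ex x A) B))
  | excludedMiddle (A : QS4Formula V) : QS4Derivable Γ (or A (neg A))
  -- Modal schemes and necessitation.
  | boxElim (A : QS4Formula V) : QS4Derivable Γ (imp (box A) A)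
  | boxBox (A : QS4Formula V) : QS4Derivable Γ (imp (box A) (box (box A)))
  | boxImp (A B : QS4Formula V) :
      QS4Derivable Γ (imp (box (imp A B)) (imp (box A) (box B)))
  | necessitation {A : QS4Formula V} : QS4Derivable Γ A → QS4Derivable Γ (box A)

/-! ## The interpretation -/

/-- The predicate variables of the target QS4: the proposition variables of QHC (the summand `ℕ`)
together with any further predicate variables `E n`. -/
abbrev QS4Vocabulary (E : ℕ → Type) : ℕ → Type := fun n => ℕ ⊕ E n

/-- The `□`-interpretation `A ↦ A_□` of formulas of QHC, where `r n k` is the `n`-ary predicate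
variable as which the `k`-th `n`-ary problem variable is retyped. -/
def boxInterpretation {E : ℕ → Type} (r : (n : ℕ) → ℕ → QS4Vocabulary E n) :
    {s : Kind} → QHCFormula s → QS4Formula (QS4Vocabulary E)
  | _, .atom .proposition n k t => .atom n (Sum.inl k) t
  | _, .atom .problem n k t => .box (.atom n (r n k) t)
  | _, .falsum _ => .falsum
  | _, .and A B => .and (boxInterpretation r A) (boxInterpretation r B)
  | _, .or A B => .or (boxInterpretation r A) (boxInterpretation r B)
  | _, .imp (s := .proposition) A B => .imp (boxInterpretation r A) (boxInterpretation r B)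
  | _, .imp (s := .problem) A B => .box (.imp (boxInterpretation r A) (boxInterpretation r B))
  | _, .all (s := .proposition) x A => .all x (boxInterpretation r A)
  | _, .all (s := .problem) x A => .box (.all x (boxInterpretation r A))
  | _, .ex x A => .ex x (boxInterpretation r A)
  | _, .bang p => .box (boxInterpretation r p)
  | _, .quest a => boxInterpretation r a

/-! The proof is an induction on QHC derivations: every scheme translates to a theorem of QS4 and
every rule to a derived rule. Call `X` stable if QS4 proves `X → □X`. The key fact,
`boxInterpretation_imp_box`, is that translations of problems are stable: each is boxed outright, is
`0`, or is built from stable formulas by `∧`, `∨`, `∃`. Nested intuitionistic implications acquire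
inner boxes, and stability of the outer antecedents allows these boxes to be introduced
(`box_imp_box_imp`, `box_imp_box_imp_box_imp`). The same fact is the content of `α → !?α`, while the
axioms for `?` become tautologies or instances of `□p → p`. -/

namespace QS4Formula

variable {V : ℕ → Type}

theorem subst_self (x : ℕ) (A : QS4Formula V) : subst x x A = A := by
  induction A with
  | atom n P t =>
    simp only [subst]
    congr 1
    funext i
    split_ifs with h
    · exact h.symm
    · rfl
  | _ => simp_all [subst]

theorem freeFor_self (x : ℕ) (A : QS4Formula V) : FreeFor x x A := by
  induction A with
  | all z A ih => exact fun h => ⟨fun e => h.1 e.symm, ih⟩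
  | ex z A ih => exact fun h => ⟨fun e => h.1 e.symm, ih⟩
  | _ => simp_all [FreeFor]

end QS4Formula

/-! ### Hypothetical reasoning in QS4 -/

open QS4Formula in
/-- Consequences of local assumptions `T` over the theorems of QS4 from the premises `Γ`: modus
ponens is the only rule that applies to formulas depending on `T`. -/
inductive QS4LocallyDerivable {V : ℕ → Type} (Γ T : Set (QS4Formula V)) : QS4Formula V → Prop
  | hyp {A : QS4Formula V} (h : A ∈ T) : QS4LocallyDerivable Γ T A
  | thm {A : QS4Formula V} (h : QS4Derivable Γ A) : QS4LocallyDerivable Γ T A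
  | mp {A B : QS4Formula V} : QS4LocallyDerivable Γ T (imp A B) → QS4LocallyDerivable Γ T A →
      QS4LocallyDerivable Γ T B

namespace QS4Derivable

open QS4Formula

variable {V : ℕ → Type} {Γ : Set (QS4Formula V)} {A B C X Y Z : QS4Formula V}

theorem imp_refl (A : QS4Formula V) : QS4Derivable Γ (imp A A) :=
  mp (impK A A) (mp (impK A (imp A A)) (impS _ _ _))

end QS4Derivable

namespace QS4LocallyDerivable

open QS4Formula

variable {V : ℕ → Type} {Γ T : Set (QS4Formula V)} {A B C X : QS4Formula V}

/-- The deduction theorem for local assumptions. -/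
theorem deduction (h : QS4LocallyDerivable Γ (insert A T) B) :
    QS4LocallyDerivable Γ T (imp A B) := by
  induction h with
  | hyp h =>
    rcases h with rfl | h
    · exact thm (.imp_refl _)
    · exact mp (thm (.impK _ _)) (hyp h)
  | thm h => exact mp (thm (.impK _ _)) (thm h)
  | mp _ _ ih₁ ih₂ => exact mp (mp (thm (.impS _ _ _)) ih₁) ih₂

theorem derivable (h : QS4LocallyDerivable Γ ∅ A) : QS4Derivable Γ A := by
  induction h with
  | hyp h => exact h.elim
  | thm h => exact h
  | mp _ _ ih₁ ih₂ => exact .mp ih₂ ih₁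

/-- For `QS4Derivable` itself the analogous rule fails, since necessitation may be applied to
premises: `A ⊢ □A` without `⊢ A → □A`. Keeping `A` local avoids this. -/
theorem imp_of (h : QS4LocallyDerivable Γ {A} B) : QS4Derivable Γ (imp A B) :=
  derivable (deduction (by simpa using h))

theorem imp_imp_of (h : QS4LocallyDerivable Γ {B, A} C) :
    QS4Derivable Γ (imp A (imp B C)) :=
  imp_of (deduction h)

theorem imp_imp_imp_of (h : QS4LocallyDerivable Γ {C, B, A} X) :
    QS4Derivable Γ (imp A (imp B (imp C X))) :=
  imp_imp_of (deduction h)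

end QS4LocallyDerivable

/-! ### Derived rules and stable formulas in QS4 -/

namespace QS4Derivable

open QS4Formula
open QS4LocallyDerivable (imp_of imp_imp_of)

variable {V : ℕ → Type} {Γ : Set (QS4Formula V)} {A B C X Y Z : QS4Formula V}

theorem imp_trans (h₁ : QS4Derivable Γ (imp A B)) (h₂ : QS4Derivable Γ (imp B C)) :
    QS4Derivable Γ (imp A C) :=
  imp_of (.mp (.thm h₂) (.mp (.thm h₁) (.hyp (by simp))))

theorem and_intro (h₁ : QS4Derivable Γ A) (h₂ : QS4Derivable Γ B) : QS4Derivable Γ (and A B) :=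
  mp h₂ (mp h₁ (andIntro A B))

theorem iff_refl (A : QS4Formula V) : QS4Derivable Γ (and (imp A A) (imp A A)) :=
  and_intro (imp_refl A) (imp_refl A)

theorem box_mono (h : QS4Derivable Γ (imp A B)) : QS4Derivable Γ (imp (box A) (box B)) :=
  mp (necessitation h) (boxImp A B)

/-- A formula implying its own necessitation may be used under a box. -/
theorem imp_box (hX : QS4Derivable Γ (imp X (box X))) (h : QS4Derivable Γ (imp X Y)) :
    QS4Derivable Γ (imp X (box Y)) :=
  imp_trans hX (box_mono h)

/-- Stability of `X` gives `X → □(Y → Z)`; distributing the box leaves `□Y`, which stability of `Y`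
supplies. -/
theorem imp_imp_box (hX : QS4Derivable Γ (imp X (box X))) (hY : QS4Derivable Γ (imp Y (box Y)))
    (h : QS4Derivable Γ (imp X (imp Y Z))) : QS4Derivable Γ (imp X (imp Y (box Z))) :=
  imp_imp_of (.mp (.mp (.thm (boxImp Y Z)) (.mp (.thm (imp_box hX h)) (.hyp (by simp))))
    (.mp (.thm hY) (.hyp (by simp))))

/-- The translation of a derivable intuitionistic implication with two antecedents. -/
theorem box_imp_box_imp (hX : QS4Derivable Γ (imp X (box X)))
    (h : QS4Derivable Γ (imp X (imp Y Z))) :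
    QS4Derivable Γ (box (imp X (box (imp Y Z)))) :=
  -- The last antecedent `Y` need not be stable: the inner box has to pass only over `X`.
  necessitation (imp_box hX h)

/-- The translation of a derivable intuitionistic implication with three antecedents. -/
theorem box_imp_box_imp_box_imp (hX : QS4Derivable Γ (imp X (box X)))
    (hY : QS4Derivable Γ (imp Y (box Y))) (h : QS4Derivable Γ (imp X (imp Y (imp Z C)))) :
    QS4Derivable Γ (box (imp X (box (imp Y (box (imp Z C)))))) :=
  box_imp_box_imp hX (imp_imp_box hX hY h)

theorem all_elim_self (x : ℕ) (A : QS4Formula V) : QS4Derivable Γ (imp (all x A) A) := by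
  simpa only [subst_self] using allElim (Γ := Γ) x x A (freeFor_self x A)

theorem ex_intro_self (x : ℕ) (A : QS4Formula V) : QS4Derivable Γ (imp A (ex x A)) := by
  simpa only [subst_self] using exIntro (Γ := Γ) x x A (freeFor_self x A)

theorem all_mono (x : ℕ) (h : QS4Derivable Γ (imp A B)) :
    QS4Derivable Γ (imp (all x A) (all x B)) :=
  mp (gen x (imp_trans (all_elim_self x A) h)) (allImp x _ _ (fun h => h.1 rfl))

theorem and_imp_box (hA : QS4Derivable Γ (imp A (box A))) (hB : QS4Derivable Γ (imp B (box B))) :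
    QS4Derivable Γ (imp (and A B) (box (and A B))) :=
  imp_of (.mp (.mp (.thm (imp_imp_box hA hB (andIntro A B)))
    (.mp (.thm (andLeft A B)) (.hyp rfl))) (.mp (.thm (andRight A B)) (.hyp rfl)))

theorem or_imp_box (hA : QS4Derivable Γ (imp A (box A))) (hB : QS4Derivable Γ (imp B (box B))) :
    QS4Derivable Γ (imp (or A B) (box (or A B))) :=
  mp (imp_box hB (orRight A B)) (mp (imp_box hA (orLeft A B)) (orElim _ _ _))

/-- `A → □∃x A` follows by boxing `A → ∃x A`; as `x` is not free in `□∃x A`, the antecedent can be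
quantified existentially. -/
theorem ex_imp_box (x : ℕ) (hA : QS4Derivable Γ (imp A (box A))) :
    QS4Derivable Γ (imp (ex x A) (box (ex x A))) :=
  mp (gen x (imp_box hA (ex_intro_self x A))) (exImp x _ _ (fun h => h.1 rfl))

end QS4Derivable

/-! ### The interpretation: compatibility with substitution, stability, soundness -/

section Interpretation

variable {E : ℕ → Type} (r : (n : ℕ) → ℕ → QS4Vocabulary E n)

/-- The translation only inserts boxes and erases `!` and `?`, none of which binds variables. This
and the next two lemmas transfer the quantifier schemes with their side conditions. -/
theorem isFree_boxInterpretation (x : ℕ) {s : Kind} (A : QHCFormula s) :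
    (boxInterpretation r A).IsFree x ↔ A.IsFree x := by
  induction A with
  | atom s => cases s <;> rfl
  | imp A B ihA ihB =>
    rename_i s
    cases s <;> simp [boxInterpretation, QS4Formula.IsFree, QHCFormula.IsFree, ihA, ihB]
  | all z A ih =>
    rename_i s
    cases s <;> simp [boxInterpretation, QS4Formula.IsFree, QHCFormula.IsFree, ih]
  | _ => simp_all [boxInterpretation, QS4Formula.IsFree, QHCFormula.IsFree]

theorem freeFor_boxInterpretation (x y : ℕ) {s : Kind} (A : QHCFormula s) :
    (boxInterpretation r A).FreeFor x y ↔ A.FreeFor x y := by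
  induction A with
  | atom s => cases s <;> rfl
  | imp A B ihA ihB =>
    rename_i s
    cases s <;> simp [boxInterpretation, QS4Formula.FreeFor, QHCFormula.FreeFor, ihA, ihB]
  | all z A ih =>
    rename_i s
    cases s <;> simp [boxInterpretation, QS4Formula.FreeFor, QHCFormula.FreeFor,
      QS4Formula.IsFree, QHCFormula.IsFree, isFree_boxInterpretation, ih]
  | _ =>
    simp_all [boxInterpretation, QS4Formula.FreeFor, QHCFormula.FreeFor,
      QS4Formula.IsFree, QHCFormula.IsFree, isFree_boxInterpretation]

theorem boxInterpretation_subst (x y : ℕ) {s : Kind} (A : QHCFormula s) :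
    boxInterpretation r (A.subst x y) = (boxInterpretation r A).subst x y := by
  induction A with
  | atom s => cases s <;> rfl
  | imp A B ihA ihB =>
    rename_i s
    cases s <;> simp [boxInterpretation, QS4Formula.subst, QHCFormula.subst, ihA, ihB]
  | all z A ih =>
    rename_i s
    cases s <;> simp only [boxInterpretation, QS4Formula.subst, QHCFormula.subst] <;>
      split_ifs <;> simp [boxInterpretation, ih]
  | ex z A ih =>
    simp only [boxInterpretation, QS4Formula.subst, QHCFormula.subst]
    split_ifs <;> simp [boxInterpretation, ih]
  | _ => simp_all [boxInterpretation, QS4Formula.subst, QHCFormula.subst]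

open QS4Derivable in
/-- The interpretation of a problem implies its own necessitation. -/
theorem boxInterpretation_imp_box {Γ : Set (QS4Formula (QS4Vocabulary E))} :
    {s : Kind} → (a : QHCFormula s) → s = .problem →
    QS4Derivable Γ (.imp (boxInterpretation r a) (.box (boxInterpretation r a)))
  -- A formula `?α` is a proposition, so it does not occur here, and `!p` is already boxed; the
  -- recursion therefore never enters a proposition.
  | .problem, .atom _ _ _ _, _ => boxBox _
  | .problem, .falsum _, _ => explosion _
  | .problem, .and A B, h =>
    and_imp_box (boxInterpretation_imp_box A h) (boxInterpretation_imp_box B h)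
  | .problem, .or A B, h =>
    or_imp_box (boxInterpretation_imp_box A h) (boxInterpretation_imp_box B h)
  | .problem, .imp _ _, _ => boxBox _
  | .problem, .all _ _, _ => boxBox _
  | .problem, .ex x A, h => ex_imp_box x (boxInterpretation_imp_box A h)
  | .problem, .bang _, _ => boxBox _

open QS4Derivable in
open QS4LocallyDerivable (imp_imp_of imp_imp_imp_of) in
/-- Derivability in QHC is preserved by the `□`-interpretation. -/
theorem qs4Derivable_boxInterpretation {Δ : Set QHCAnyFormula}
    {Γ : Set (QS4Formula (QS4Vocabulary E))}
    (hΓ : ∀ A ∈ Δ, QS4Derivable Γ (boxInterpretation r A.2)) {s : Kind} {B : QHCFormula s}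
    (h : QHCDerivable Δ B) : QS4Derivable Γ (boxInterpretation r B) := by
  have stable (a : QHCFormula .problem) := boxInterpretation_imp_box r (Γ := Γ) a rfl
  induction h with
  | premise h => exact hΓ _ h
  | @mp s A B _ _ ih₁ ih₂ =>
    cases s
    · exact mp ih₁ ih₂
    · exact mp ih₁ (mp ih₂ (boxElim _))
  | @gen s A x _ ih =>
    cases s
    · exact gen x ih
    · exact necessitation (gen x ih)
  | @impK s A B =>
    cases s
    · exact impK _ _
    · exact box_imp_box_imp (stable A) (impK _ _)
  | @impS s A B C =>
    cases s
    · exact impS _ _ _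
    -- The first two antecedents are boxed implications, hence stable. What remains is the usual
    -- argument for S with the boxes removed by `boxElim`.
    · refine box_imp_box_imp_box_imp (boxBox _) (boxBox _) (imp_imp_imp_of ?_)
      exact .mp
        (.mp (.thm (boxElim _)) (.mp (A := boxInterpretation r A)
          (.mp (.thm (boxElim _)) (.hyp (.inr (.inr rfl)))) (.hyp (.inl rfl))))
        (.mp (A := boxInterpretation r A) (B := boxInterpretation r B)
          (.mp (.thm (boxElim _)) (.hyp (.inr (.inl rfl)))) (.hyp (.inl rfl)))
  | @andLeft s A B =>
    cases s
    · exact andLeft _ _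
    · exact necessitation (andLeft _ _)
  | @andRight s A B =>
    cases s
    · exact andRight _ _
    · exact necessitation (andRight _ _)
  | @andIntro s A B =>
    cases s
    · exact andIntro _ _
    · exact box_imp_box_imp (stable A) (andIntro _ _)
  | @orLeft s A B =>
    cases s
    · exact orLeft _ _
    · exact necessitation (orLeft _ _)
  | @orRight s A B =>
    cases s
    · exact orRight _ _
    · exact necessitation (orRight _ _)
  | @orElim s A B C =>
    cases s
    · exact orElim _ _ _
    · refine box_imp_box_imp_box_imp (boxBox _) (boxBox _) (imp_imp_of ?_)
      exact .mp (.mp (.thm (orElim _ _ _)) (.mp (.thm (boxElim _)) (.hyp (.inr rfl))))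
        (.mp (.thm (boxElim _)) (.hyp (.inl rfl)))
  | @explosion s A =>
    cases s
    · exact explosion _
    · exact necessitation (explosion _)
  | @allElim s x y A h =>
    have key := allElim (Γ := Γ) x y _ ((freeFor_boxInterpretation r x y A).2 h)
    rw [← boxInterpretation_subst] at key
    cases s
    · exact key
    · exact necessitation (imp_trans (boxElim _) key)
  | @exIntro s x y A h =>
    have key := exIntro (Γ := Γ) x y _ ((freeFor_boxInterpretation r x y A).2 h)
    rw [← boxInterpretation_subst] at key
    cases s
    · exact key
    · exact necessitation key
  | @allImp s x A B h =>
    have key := allImp (Γ := Γ) x _ (boxInterpretation r B)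
      (mt (isFree_boxInterpretation r x A).1 h)
    cases s
    · exact key
    -- The box before `∀x B` lies under both antecedents, so stability of `A` is needed as well as
    -- that of the boxed universal formula.
    · exact necessitation (imp_box (boxBox _) (imp_imp_box (boxBox _) (stable A)
        (imp_trans (boxElim _) (imp_trans (all_mono x (boxElim _)) key))))
  | @exImp s x A B h =>
    have key := exImp (Γ := Γ) x (boxInterpretation r A) _
      (mt (isFree_boxInterpretation r x B).1 h)
    cases s
    · exact key
    · exact box_imp_box_imp (boxBox _)
        (imp_trans (boxElim _) (imp_trans (all_mono x (boxElim _)) key))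
  | excludedMiddle p => exact excludedMiddle _
  -- Since `?` is erased and `∧`, `∨`, `∃` translate alike in both types, the two sides of each
  -- equivalence for `?` coincide.
  | questAnd a b => exact iff_refl _
  | questOr a b => exact iff_refl _
  | questImp a b => exact boxElim _
  | questFalsum => exact imp_refl _
  | questEx x a => exact iff_refl _
  | questAll x a => exact boxElim _
  | questTop _ ih => exact ih
  | bangFalsum => exact necessitation (boxElim _)
  | questBang p => exact boxElim _
  | bangImp p q => exact box_imp_box_imp (boxBox _) (boxImp _ _)
  | bangTop _ ih => exact necessitation ih
  | bangQuest a => exact necessitation (stable a)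

end Interpretation

theorem mainTheorem2 {E : ℕ → Type} (r : (n : ℕ) → ℕ → QS4Vocabulary E n)
    (n : ℕ) (A : Fin n → QHCAnyFormula) {s : Kind} (B : QHCFormula s)
    (h : QHCDerivable (Set.range A) B) :
    QS4Derivable (Set.range fun i => boxInterpretation r (A i).2) (boxInterpretation r B) := by
  refine qs4Derivable_boxInterpretation r ?_ h
  rintro _ ⟨i, rfl⟩
  exact .premise ⟨i, rfl⟩
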